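/- Let $r,a_+,a_->0$. For $\alpha>0$ and $z\in\mathbb C$ put $$R(r,\alpha;z)=\prod_{k=1}^{\infty}\bigl[1-e^{2irz-(2k-1)\alpha r}\bigr]\bigl[1-e^{-2irz-(2k-1)\alpha r}\bigr],\qquad R_\delta(z)=R(r,a_\delta;z)\quad(\delta=+,-),$$ and let $$G(z)=\prod_{m,n=0}^{\infty}\frac{1-\exp\bigl(-(2m+1)ra_+-(2n+1)ra_--2irz\bigr)}{1-\exp\bigl(-(2m+1)ra_+-(2n+1)ra_-+2irz\bigr)}$$ be the elliptic gamma function. For $v,w,z\in\mathbb C^3$ define $$\mathcal S_2(v,w,z)=\prod_{k,l,m=1}^{3}G(v_k+w_l+z_m-\delta_2),\qquad \delta_2=\tfrac{i}{6}(a_++a_-).$$ For $\delta\in\{+,-\}$ and $\mu\in\mathbb C$ let $A_{2,\delta}(\mu;x)$ be the analytic difference operator $$(A_{2,\delta}(\mu;x)f)(x)=\sum_{j=1}^{3}\frac{R_\delta(x_{j+1}-x_{j+2}+\mu)\,R_\delta(x_{j+1}-x_{j+2}-\mu)}{R_\delta(x_j-x_{j+1}-ia_\delta/2)\,R_\delta(x_j-x_{j+2}-ia_\delta/2)}\;f\bigl(x+\tfrac{i}{3}a_{-\delta}(3e_j-e_1-e_2-e_3)\bigr),$$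 where indices are read modulo $3$ and $e_1,e_2,e_3$ is the standard basis of $\mathbb C^3$. Then for all $\mu\in\mathbb C$ and $\delta=+,-$, on the set of $v,w,z\in\mathbb C^3$ with $\sum_{j}v_j=\sum_{j}w_j=\sum_{j}z_j=0$, one has $$A_{2,\delta}(\mu;v)\,\mathcal S_2(v,w,z)=A_{2,\delta}(\mu;w)\,\mathcal S_2(v,w,z)=A_{2,\delta}(\mu;z)\,\mathcal S_2(v,w,z)$$ as an equality of meromorphic functions; that is, any two of these three expressions take the same value at every such $(v,w,z)$ at which, in both of them, no denominator $R_\delta$ of a coefficient vanishes and no factor $G$ of a shifted $\mathcal S_2$ has a pole. -/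

import Mathlib

noncomputable section

namespace Razamat

open Complex

/-- The elliptic building block `R(r, α; z)`, the product of
`(1 - exp(2irz - (2k-1)αr)) (1 - exp(-2irz - (2k-1)αr))` over `k ≥ 1`
(here indexed by `k - 1 : ℕ`). -/
def R (r α : ℝ) (z : ℂ) : ℂ :=
  ∏' k : ℕ, (1 - exp (2 * I * r * z - (2 * k + 1) * α * r)) *
    (1 - exp (-2 * I * r * z - (2 * k + 1) * α * r))

/-- The elliptic gamma function `G(r, a₊, a₋; z)`. -/
def G (r ap am : ℝ) (z : ℂ) : ℂ :=
  ∏' p : ℕ × ℕ,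
    (1 - exp (-(2 * p.1 + 1) * r * ap - (2 * p.2 + 1) * r * am - 2 * I * r * z)) /
    (1 - exp (-(2 * p.1 + 1) * r * ap - (2 * p.2 + 1) * r * am + 2 * I * r * z))

/-- `z` is not a pole of the elliptic gamma function: no denominator factor vanishes
(numerator and denominator factors have no common zeros when `r, a₊, a₋ > 0`). -/
def GRegular (r ap am : ℝ) (z : ℂ) : Prop :=
  ∀ m n : ℕ,
    1 - exp (-(2 * m + 1) * r * ap - (2 * n + 1) * r * am + 2 * I * r * z) ≠ 0

/-- `a_δ`, where the sign `δ = +` is encoded as `true` and `δ = -` as `false`;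
the opposite sign `-δ` is then `!δ`. -/
def aSign (ap am : ℝ) (δ : Bool) : ℝ := if δ then ap else am

/-- `R_δ(z) = R(r, a_δ; z)`. -/
def RSign (r ap am : ℝ) (δ : Bool) (z : ℂ) : ℂ := R r (aSign ap am δ) z

/-- The argument of `G` in the kernel function: `v_k + w_l + z_m - i(a₊ + a₋)/6`. -/
def kernelArg (ap am : ℝ) (v w z : Fin 3 → ℂ) (k l m : Fin 3) : ℂ :=
  v k + w l + z m - I * (ap + am) / 6

/-- The kernel function `S₂(v, w, z)`. -/
def S2 (r ap am : ℝ) (v w z : Fin 3 → ℂ) : ℂ :=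
  ∏ k, ∏ l, ∏ m, G r ap am (kernelArg ap am v w z k l m)

/-- No factor of `S₂` has a pole at `(v, w, z)`. -/
def S2Regular (r ap am : ℝ) (v w z : Fin 3 → ℂ) : Prop :=
  ∀ k l m, GRegular r ap am (kernelArg ap am v w z k l m)

/-- The shift `exp((1/3) i b (2 ∂_{x_j} - ∂_{x_{j+1}} - ∂_{x_{j+2}}))` on points:
`2ib/3` is added to `x_j` and `-ib/3` to the other two coordinates. -/
def shift (b : ℝ) (j : Fin 3) (x : Fin 3 → ℂ) : Fin 3 → ℂ :=
  fun k => x k + I * b / 3 * (if k = j then 2 else -1)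

/-- The coefficient of the `j`-th summand of the difference operator `A_{2,δ}(μ; x)`; indices
are taken modulo 3, so the summands are cyclic permutations of each other. -/
def coeff (r ap am : ℝ) (δ : Bool) (μ : ℂ) (j : Fin 3) (x : Fin 3 → ℂ) : ℂ :=
  RSign r ap am δ (x (j + 1) - x (j + 2) + μ) * RSign r ap am δ (x (j + 1) - x (j + 2) - μ) /
    (RSign r ap am δ (x j - x (j + 1) - I * aSign ap am δ / 2) *
      RSign r ap am δ (x j - x (j + 2) - I * aSign ap am δ / 2))

/-- The analytic difference operator `A_{2,δ}(μ; x)`, applied to `f` and evaluated at `x`. -/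
def A2 (r ap am : ℝ) (δ : Bool) (μ : ℂ) (f : (Fin 3 → ℂ) → ℂ) (x : Fin 3 → ℂ) : ℂ :=
  ∑ j, coeff r ap am δ μ j x * f (shift (aSign ap am (!δ)) j x)

/-- Every summand of `A_{2,δ}(μ; x) f` is regular at `x`: the denominators of the coefficients
do not vanish, and the three shifted points are regular points of `f` (described by `reg`). -/
def A2Regular (r ap am : ℝ) (δ : Bool) (reg : (Fin 3 → ℂ) → Prop) (x : Fin 3 → ℂ) : Prop :=
  (∀ j k, j ≠ k → RSign r ap am δ (x j - x k - I * aSign ap am δ / 2) ≠ 0) ∧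
    ∀ j, reg (shift (aSign ap am (!δ)) j x)

end Razamat

end

noncomputable section

namespace Razamat

open Complex

/-! Shifting an argument of `G` by `i a_{-δ}` multiplies it by a value of `R_δ`, so each shifted
kernel is a product of nine values of `R_δ` times a factor that is independent of the summand and
symmetric in `v` and `w`. Rewriting `R_δ` through the odd theta function `sigma` turns the rest into
`razSum`, and the theorem becomes the symmetry of `razSum` in `v` and `w` (`razSum_comm`).

That symmetry uses the three-term identity twice. For `z = (c, -c/2 + y, -c/2 - y)` the products `s
(A + y) * s (A - y)` span at most a plane of functions of `y`, so both sides are binary cubic forms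
in a basis of it, and they agree once they agree at four values of `y`
(`razSum_comm_of_four_points`). For generic data the four values make `z 1` equal to some `-(v k + w
l)`. A second interpolation then uses two points where all terms vanish and two where just three
terms survive; there the claim is the three-term identity itself (`razSum_comm_of_degenerate`).
Continuity removes genericity.

The three-term identity for `sigma` is a dimension count: theta functions of degree two are
determined by two Fourier coefficients (`eq_zero_of_quasiperiodic`). -/

/-! ### Odd functions with a three-term identity, and cubic forms -/

/-- An odd function satisfying the three-term identity of Weierstrass. -/
structure SigmaLike (s : ℂ → ℂ) : Prop where
  neg : ∀ x, s (-x) = -s x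
  three_term : ∀ x y z w, s (x + y) * s (x - y) * (s (z + w) * s (z - w)) -
    s (x + z) * s (x - z) * (s (y + w) * s (y - w)) +
    s (x + w) * s (x - w) * (s (y + z) * s (y - z)) = 0

namespace SigmaLike

variable {s : ℂ → ℂ}

theorem zero (hs : SigmaLike s) : s 0 = 0 := by
  have h := hs.neg 0
  rw [neg_zero] at h
  linear_combination h / 2

theorem sub_comm (hs : SigmaLike s) (x y : ℂ) : s (x - y) = -s (y - x) := by
  rw [← hs.neg, neg_sub]

end SigmaLike

/-- `N` is a homogeneous cubic polynomial in `g` and `h`. -/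
def IsCubicIn (g h N : ℂ → ℂ) : Prop :=
  ∃ a b c d : ℂ, ∀ y, N y = a * g y ^ 3 + b * g y ^ 2 * h y + c * g y * h y ^ 2 + d * h y ^ 3

namespace IsCubicIn

variable {g h N M : ℂ → ℂ}

theorem sub (hN : IsCubicIn g h N) (hM : IsCubicIn g h M) :
    IsCubicIn g h (fun y => N y - M y) := by
  obtain ⟨a, b, c, d, hN⟩ := hN
  obtain ⟨a', b', c', d', hM⟩ := hM
  exact ⟨a - a', b - b', c - c', d - d', fun y => by simp only [hN, hM]; ring⟩

theorem add (hN : IsCubicIn g h N) (hM : IsCubicIn g h M) :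
    IsCubicIn g h (fun y => N y + M y) := by
  obtain ⟨a, b, c, d, hN⟩ := hN
  obtain ⟨a', b', c', d', hM⟩ := hM
  exact ⟨a + a', b + b', c + c', d + d', fun y => by simp only [hN, hM]; ring⟩

theorem const_mul (hN : IsCubicIn g h N) (C : ℂ) : IsCubicIn g h (fun y => C * N y) := by
  obtain ⟨a, b, c, d, hN⟩ := hN
  exact ⟨C * a, C * b, C * c, C * d, fun y => by simp only [hN]; ring⟩

/-- A product of three linear forms is a cubic form. -/
theorem of_linear {L : Fin 3 → ℂ → ℂ} (hL : ∀ l, ∃ α β : ℂ, ∀ y, L l y = α * g y + β * h y) :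
    IsCubicIn g h (fun y => ∏ l, L l y) := by
  choose α β hL using hL
  refine ⟨α 0 * α 1 * α 2, α 0 * α 1 * β 2 + α 0 * β 1 * α 2 + β 0 * α 1 * α 2,
    α 0 * β 1 * β 2 + β 0 * α 1 * β 2 + β 0 * β 1 * α 2, β 0 * β 1 * β 2, fun y => ?_⟩
  simp only [Fin.prod_univ_three, hL]
  ring

end IsCubicIn

/-- Abbreviation for the product `s (x + y) * s (x - y)`. -/
def pairProd (s : ℂ → ℂ) (x y : ℂ) : ℂ := s (x + y) * s (x - y)

namespace SigmaLike

variable {s : ℂ → ℂ}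

theorem pluecker (hs : SigmaLike s) (x y z w : ℂ) :
    pairProd s x y * pairProd s z w - pairProd s x z * pairProd s y w +
      pairProd s x w * pairProd s y z = 0 := hs.three_term x y z w

theorem pairProd_self (hs : SigmaLike s) (x : ℂ) : pairProd s x x = 0 := by
  simp [pairProd, hs.zero]

theorem pairProd_swap (hs : SigmaLike s) (x y : ℂ) : pairProd s x y = -pairProd s y x := by
  rw [pairProd, pairProd, hs.sub_comm x y, add_comm]; ring

/-- The Plücker relation for `A, y, p, q`, solved for `pairProd s A y`. -/
theorem pairProd_linear (hs : SigmaLike s) {p q : ℂ} (hpq : pairProd s p q ≠ 0) (A : ℂ) :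
    ∃ α β : ℂ, ∀ y, pairProd s A y = α * pairProd s y q + β * pairProd s y p := by
  refine ⟨pairProd s A p / pairProd s p q, -pairProd s A q / pairProd s p q, fun y => ?_⟩
  have h := hs.pluecker A y p q
  field_simp
  linear_combination h

/-- A cubic form in two even functions of degree two that vanishes at four points, distinct up to
sign, vanishes identically. -/
theorem cubic_eq_zero (hs : SigmaLike s) {Y : Fin 4 → ℂ}
    (hY : ∀ i j, i < j → pairProd s (Y i) (Y j) ≠ 0) {N : ℂ → ℂ}
    (hN : IsCubicIn (fun y => pairProd s y (Y 1)) (fun y => pairProd s y (Y 0)) N)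
    (h0 : ∀ i, N (Y i) = 0) (y : ℂ) : N y = 0 := by
  obtain ⟨a, b, c, d, hN⟩ := hN
  have h01 := hY 0 1 (by decide)
  have h02 := hY 0 2 (by decide)
  have h03 := hY 0 3 (by decide)
  have h12 := hY 1 2 (by decide)
  have h13 := hY 1 3 (by decide)
  have h23 := hY 2 3 (by decide)
  have e0 := h0 0
  have e1 := h0 1
  have e2 := h0 2
  have e3 := h0 3
  rw [hN] at e0 e1 e2 e3
  simp only [hs.pairProd_self] at e0 e1
  rw [hs.pairProd_swap (Y 1) (Y 0)] at e1
  -- At `Y 0` the second basis function vanishes and at `Y 1` the first, which isolates the pure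
  -- cubes.
  have ha : a = 0 := by
    have : a * pairProd s (Y 0) (Y 1) ^ 3 = 0 := by linear_combination e0
    simpa [h01] using this
  have hd : d = 0 := by
    have : d * pairProd s (Y 0) (Y 1) ^ 3 = 0 := by linear_combination -e1
    simpa [h01] using this
  subst ha hd
  simp only [hs.pairProd_swap (Y 2) (Y 1), hs.pairProd_swap (Y 2) (Y 0)] at e2
  simp only [hs.pairProd_swap (Y 3) (Y 1), hs.pairProd_swap (Y 3) (Y 0)] at e3
  have f2 : b * pairProd s (Y 1) (Y 2) + c * pairProd s (Y 0) (Y 2) = 0 := by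
    have : pairProd s (Y 1) (Y 2) * pairProd s (Y 0) (Y 2) *
      (b * pairProd s (Y 1) (Y 2) + c * pairProd s (Y 0) (Y 2)) = 0 := by linear_combination -e2
    simpa [h12, h02] using this
  have f3 : b * pairProd s (Y 1) (Y 3) + c * pairProd s (Y 0) (Y 3) = 0 := by
    have : pairProd s (Y 1) (Y 3) * pairProd s (Y 0) (Y 3) *
      (b * pairProd s (Y 1) (Y 3) + c * pairProd s (Y 0) (Y 3)) = 0 := by linear_combination -e3
    simpa [h13, h03] using this
  have pl := hs.pluecker (Y 0) (Y 1) (Y 2) (Y 3)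
  -- By the Plücker relation, the determinant of the system `f2`, `f3` is, up to sign, the nonzero
  -- product of the pairs `01` and `23`.
  have hb : b = 0 := by
    have : b * (pairProd s (Y 0) (Y 1) * pairProd s (Y 2) (Y 3)) = 0 := by
      linear_combination b * pl + pairProd s (Y 0) (Y 2) * f3 - pairProd s (Y 0) (Y 3) * f2
    simpa [h01, h23] using this
  have hc : c = 0 := by
    rw [hb] at f2
    simpa [h02] using f2
  rw [hN, hb, hc]
  ring

end SigmaLike

/-! ### The reduced sum and its permutation symmetries -/

/-- A summand of `razSum`. -/
def razTerm (s : ℂ → ℂ) (ν a b c : ℂ) (w z : Fin 3 → ℂ) : ℂ :=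
  s (b - c + ν) * s (b - c - ν) / (s (a - b) * s (a - c)) * ∏ l, ∏ m, s (a + w l + z m)

/-- The action of the difference operator on the kernel function, divided by a symmetric factor and
written in terms of an odd function `s`. -/
def razSum (s : ℂ → ℂ) (ν : ℂ) (v w z : Fin 3 → ℂ) : ℂ :=
  ∑ j, razTerm s ν (v j) (v (j + 1)) (v (j + 2)) w z

section symmetry

variable {s : ℂ → ℂ} (ν : ℂ) (v w z : Fin 3 → ℂ)

theorem razSum_comp_second (σ : Equiv.Perm (Fin 3)) :
    razSum s ν v (w ∘ σ) z = razSum s ν v w z := by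
  refine Finset.sum_congr rfl fun j _ => ?_
  simp only [razTerm, Function.comp_apply]
  rw [Equiv.prod_comp σ (fun l => ∏ m, s (v j + w l + z m))]

theorem razTerm_swap (hs : SigmaLike s) (a b c : ℂ) :
    razTerm s ν a b c w z = razTerm s ν a c b w z := by
  have h1 : s (b - c + ν) = -s (c - b - ν) := by rw [← hs.neg]; ring_nf
  have h2 : s (b - c - ν) = -s (c - b + ν) := by rw [← hs.neg]; ring_nf
  rw [razTerm, razTerm, h1, h2, mul_comm (s (a - b))]
  ring

theorem razSum_comp_first (hs : SigmaLike s) (σ : Equiv.Perm (Fin 3)) :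
    razSum s ν (v ∘ σ) w z = razSum s ν v w z := by
  -- A permutation of three letters keeps or reverses the cyclic order; a reversal only exchanges
  -- `b` and `c` in `razTerm`.
  have key : ∀ (σ : Equiv.Perm (Fin 3)) (j : Fin 3),
      (σ (j + 1) = σ j + 1 ∧ σ (j + 2) = σ j + 2) ∨
      (σ (j + 1) = σ j + 2 ∧ σ (j + 2) = σ j + 1) := by decide
  rw [razSum, razSum,
    ← Equiv.sum_comp σ (fun j => razTerm s ν (v j) (v (j + 1)) (v (j + 2)) w z)]
  refine Finset.sum_congr rfl fun j _ => ?_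
  simp only [Function.comp_apply]
  rcases key σ j with ⟨h1, h2⟩ | ⟨h1, h2⟩ <;> rw [h1, h2]
  exact razTerm_swap ν w z hs _ _ _

theorem razSum_comp_third (σ : Equiv.Perm (Fin 3)) :
    razSum s ν v w (z ∘ σ) = razSum s ν v w z := by
  refine Finset.sum_congr rfl fun j _ => ?_
  simp only [razTerm, Function.comp_apply]
  congr 1
  exact Finset.prod_congr rfl fun l _ => Equiv.prod_comp σ (fun m => s (v j + w l + z m))

theorem razSum_eq_zero (hs : SigmaLike s) (h : ∀ j, ∃ l m, v j + w l + z m = 0) :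
    razSum s ν v w z = 0 := by
  refine Finset.sum_eq_zero fun j _ => ?_
  obtain ⟨l, m, hlm⟩ := h j
  rw [razTerm, Finset.prod_eq_zero (Finset.mem_univ l), mul_zero]
  rw [Finset.prod_eq_zero (Finset.mem_univ m)]
  rw [hlm, hs.zero]

end symmetry

/-! ### Symmetry of the reduced sum by two interpolations -/

section identity

variable {s : ℂ → ℂ}

/-- The points at which the identity reduces to the three-term relation. -/
theorem razSum_comm_of_degenerate (hs : SigmaLike s) (ν : ℂ) {v w z : Fin 3 → ℂ}
    (hv : ∑ j, v j = 0) (hw : ∑ j, w j = 0) (hz : ∑ j, z j = 0)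
    (hv' : ∀ j k, j ≠ k → s (v j - v k) ≠ 0) (hw' : ∀ j k, j ≠ k → s (w j - w k) ≠ 0)
    (h0 : z 0 = -(v 0 + w 0)) (h1 : z 1 = -(v 1 + w 0)) :
    razSum s ν v w z = razSum s ν w v z := by
  have a1 := hv' 2 0 (by decide)
  have a2 := hv' 2 1 (by decide)
  have b1 := hw' 1 0 (by decide)
  have b2 := hw' 2 0 (by decide)
  have b3 := hw' 1 2 (by decide)
  simp only [Fin.sum_univ_three] at hv hw hz
  have hv2 : v 2 = -v 0 - v 1 := by linear_combination hv
  have hw0 : w 0 = -w 1 - w 2 := by linear_combination hw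
  have h2 : z 2 = v 0 + v 1 + 2 * w 0 := by linear_combination hz - h0 - h1
  have L0 : razTerm s ν (v 0) (v 1) (v 2) w z = 0 := by
    rw [razTerm, Finset.prod_eq_zero (Finset.mem_univ 0), mul_zero]
    rw [Finset.prod_eq_zero (Finset.mem_univ 0)]
    rw [h0, add_neg_cancel, hs.zero]
  have L1 : razTerm s ν (v 1) (v 2) (v 0) w z = 0 := by
    rw [razTerm, Finset.prod_eq_zero (Finset.mem_univ 0), mul_zero]
    rw [Finset.prod_eq_zero (Finset.mem_univ 1)]
    rw [h1, add_neg_cancel, hs.zero]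
  have R0 : razTerm s ν (w 0) (w 1) (w 2) v z = 0 := by
    rw [razTerm, Finset.prod_eq_zero (Finset.mem_univ 0), mul_zero]
    rw [Finset.prod_eq_zero (Finset.mem_univ 0)]
    rw [h0, add_comm (w 0), add_neg_cancel, hs.zero]
  have key := hs.three_term (w 1 - w 0) (w 2 - w 0) (v 0 - v 1) ν
  have n1 : s (w 0 - w 1) = -s (w 1 - w 0) := hs.sub_comm _ _
  have n2 : s (w 0 - w 2) = -s (w 2 - w 0) := hs.sub_comm _ _
  have n3 : s (w 2 - w 1) = -s (w 1 - w 2) := hs.sub_comm _ _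
  -- These four factors occur, up to sign, in all three surviving terms; what multiplies them is the
  -- three-term identity `key`.
  set p := s (v 2 - v 0 + (w 1 - w 0)) with hp
  set q := s (v 2 - v 1 + (w 1 - w 0)) with hq
  set p' := s (v 2 - v 0 + (w 2 - w 0)) with hp'
  set q' := s (v 2 - v 1 + (w 2 - w 0)) with hq'
  have L2 : razTerm s ν (v 2) (v 0) (v 1) w z =
      s (v 0 - v 1 + ν) * s (v 0 - v 1 - ν) * (p * q * p' * q') * s (3 * w 0) *
        (s (w 1 - w 0) * s (w 2 - w 0)) := by
    have e00 : s (v 2 + w 0 + z 0) = s (v 2 - v 0) := by rw [h0]; ring_nf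
    have e01 : s (v 2 + w 0 + z 1) = s (v 2 - v 1) := by rw [h1]; ring_nf
    have e02 : s (v 2 + w 0 + z 2) = s (3 * w 0) := by
      rw [h2, hv2]; ring_nf
    have e10 : s (v 2 + w 1 + z 0) = p := by rw [h0, hp]; ring_nf
    have e11 : s (v 2 + w 1 + z 1) = q := by rw [h1, hq]; ring_nf
    have e12 : s (v 2 + w 1 + z 2) = s (w 0 - w 2) := by
      rw [h2, hv2]; congr 1; linear_combination hw
    have e20 : s (v 2 + w 2 + z 0) = p' := by rw [h0, hp']; ring_nf
    have e21 : s (v 2 + w 2 + z 1) = q' := by rw [h1, hq']; ring_nf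
    have e22 : s (v 2 + w 2 + z 2) = s (w 0 - w 1) := by
      rw [h2, hv2]; congr 1; linear_combination hw
    simp only [razTerm, Fin.prod_univ_three, e00, e01, e02, e10, e11, e12, e20, e21, e22, n1, n2]
    field_simp
  have R1 : razTerm s ν (w 1) (w 2) (w 0) v z =
      -(s (w 2 - w 0 + ν) * s (w 2 - w 0 - ν)) / s (w 1 - w 2) *
        (s (w 1 - w 0 + (v 0 - v 1)) * s (w 1 - w 0 - (v 0 - v 1))) * (p * q * p' * q') *
          (s (w 1 - w 0) * s (w 2 - w 0)) := by
    have e00 : s (w 1 + v 0 + z 0) = s (w 1 - w 0) := by rw [h0]; ring_nf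
    have e01 : s (w 1 + v 0 + z 1) = s (w 1 - w 0 + (v 0 - v 1)) := by rw [h1]; ring_nf
    have e02 : s (w 1 + v 0 + z 2) = -p' := by
      rw [h2, hp', ← hs.neg]; congr 1; linear_combination hv + hw
    have e10 : s (w 1 + v 1 + z 0) = s (w 1 - w 0 - (v 0 - v 1)) := by rw [h0]; ring_nf
    have e11 : s (w 1 + v 1 + z 1) = s (w 1 - w 0) := by rw [h1]; ring_nf
    have e12 : s (w 1 + v 1 + z 2) = -q' := by
      rw [h2, hq', ← hs.neg]; congr 1; linear_combination hv + hw
    have e20 : s (w 1 + v 2 + z 0) = p := by rw [h0, hp]; ring_nf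
    have e21 : s (w 1 + v 2 + z 1) = q := by rw [h1, hq]; ring_nf
    have e22 : s (w 1 + v 2 + z 2) = s (w 0 - w 2) := by
      rw [h2]; congr 1; linear_combination hv + hw
    simp only [razTerm, Fin.prod_univ_three, e00, e01, e02, e10, e11, e12, e20, e21, e22, n2]
    field_simp
  have R2 : razTerm s ν (w 2) (w 0) (w 1) v z =
      s (w 1 - w 0 + ν) * s (w 1 - w 0 - ν) / s (w 1 - w 2) *
        (s (w 2 - w 0 + (v 0 - v 1)) * s (w 2 - w 0 - (v 0 - v 1))) * (p * q * p' * q') *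
          (s (w 1 - w 0) * s (w 2 - w 0)) := by
    have e00 : s (w 2 + v 0 + z 0) = s (w 2 - w 0) := by rw [h0]; ring_nf
    have e01 : s (w 2 + v 0 + z 1) = s (w 2 - w 0 + (v 0 - v 1)) := by rw [h1]; ring_nf
    have e02 : s (w 2 + v 0 + z 2) = -p := by
      rw [h2, hp, ← hs.neg]; congr 1; linear_combination hv + hw
    have e10 : s (w 2 + v 1 + z 0) = s (w 2 - w 0 - (v 0 - v 1)) := by rw [h0]; ring_nf
    have e11 : s (w 2 + v 1 + z 1) = s (w 2 - w 0) := by rw [h1]; ring_nf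
    have e12 : s (w 2 + v 1 + z 2) = -q := by
      rw [h2, hq, ← hs.neg]; congr 1; linear_combination hv + hw
    have e20 : s (w 2 + v 2 + z 0) = p' := by rw [h0, hp']; ring_nf
    have e21 : s (w 2 + v 2 + z 1) = q' := by rw [h1, hq']; ring_nf
    have e22 : s (w 2 + v 2 + z 2) = s (w 0 - w 1) := by
      rw [h2]; congr 1; linear_combination hv + hw
    rw [razTerm_swap ν v z hs]
    have m1 : s (w 1 - w 0 + ν) * s (w 1 - w 0 - ν) / (s (w 2 - w 1) * s (w 2 - w 0)) =
      -(s (w 1 - w 0 + ν) * s (w 1 - w 0 - ν)) / (s (w 1 - w 2) * s (w 2 - w 0)) := by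
      rw [n3]; field_simp
    simp only [razTerm, m1, Fin.prod_univ_three, e00, e01, e02, e10, e11, e12, e20, e21, e22, n1]
    field_simp
  have k1 : s (w 1 - w 0 + (w 2 - w 0)) = -s (3 * w 0) := by
    rw [← hs.neg]; congr 1; linear_combination hw
  have k2 : s (w 1 - w 0 - (w 2 - w 0)) = s (w 1 - w 2) := by ring_nf
  rw [k1, k2] at key
  have L : razSum s ν v w z = razTerm s ν (v 2) (v 0) (v 1) w z := by
    have : razSum s ν v w z = razTerm s ν (v 0) (v 1) (v 2) w z +
      razTerm s ν (v 1) (v 2) (v 0) w z + razTerm s ν (v 2) (v 0) (v 1) w z :=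
      Fin.sum_univ_three _
    rw [this, L0, L1]; ring
  have R : razSum s ν w v z = razTerm s ν (w 1) (w 2) (w 0) v z +
      razTerm s ν (w 2) (w 0) (w 1) v z := by
    have : razSum s ν w v z = razTerm s ν (w 0) (w 1) (w 2) v z +
      razTerm s ν (w 1) (w 2) (w 0) v z + razTerm s ν (w 2) (w 0) (w 1) v z :=
      Fin.sum_univ_three _
    rw [this, R0]; ring
  rw [L, R, L2, R1, R2]
  clear_value p q p' q'
  field_simp
  linear_combination -(p * q * p' * q') * key

/-- As a function of `y`, where `z = (c, -c/2 + y, -c/2 - y)`, each side of the identity is a cubic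
form. -/
theorem razSum_isCubicIn (hs : SigmaLike s) (ν : ℂ) {p q : ℂ} (hpq : pairProd s p q ≠ 0)
    (v w : Fin 3 → ℂ) (c : ℂ) :
    IsCubicIn (fun y => pairProd s y q) (fun y => pairProd s y p)
      (fun y => razSum s ν v w ![c, -c / 2 + y, -c / 2 - y]) := by
  have term : ∀ a b d : ℂ, IsCubicIn (fun y => pairProd s y q) (fun y => pairProd s y p)
      (fun y => razTerm s ν a b d w ![c, -c / 2 + y, -c / 2 - y]) := by
    intro a b d
    -- For each `l`, the factors with `m = 1, 2` pair up to a linear form, and the factor with `m =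
    -- 0` is constant in `y`.
    have h := (IsCubicIn.of_linear (L := fun l y => pairProd s (a + w l - c / 2) y)
      (fun l => hs.pairProd_linear hpq (a + w l - c / 2))).const_mul
      (s (b - d + ν) * s (b - d - ν) / (s (a - b) * s (a - d)) * ∏ l, s (a + w l + c))
    refine (congrArg _ (funext fun y => ?_)).mp h
    rw [razTerm, mul_assoc, ← Finset.prod_mul_distrib]
    congr 1
    refine Finset.prod_congr rfl fun l _ => ?_
    simp only [Fin.prod_univ_three, pairProd, Matrix.cons_val_zero, Matrix.cons_val_one,
      Matrix.cons_val]
    rw [show a + w l + (-c / 2 + y) = a + w l - c / 2 + y by ring,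
      show a + w l + (-c / 2 - y) = a + w l - c / 2 - y by ring]
    ring
  simp only [razSum, Fin.sum_univ_three]
  exact ((term _ _ _).add (term _ _ _)).add (term _ _ _)

/-- The identity holds for all `z` with given `z 0` as soon as it holds at four values of `z 1`. -/
theorem razSum_comm_of_four_points (hs : SigmaLike s) (ν : ℂ) {v w z : Fin 3 → ℂ}
    (hz : ∑ j, z j = 0) (x : Fin 4 → ℂ)
    (hx : ∀ i j, i < j → s (x i + x j + z 0) ≠ 0 ∧ s (x i - x j) ≠ 0)
    (h : ∀ i, razSum s ν v w ![z 0, x i, -z 0 - x i] = razSum s ν w v ![z 0, x i, -z 0 - x i]) :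
    razSum s ν v w z = razSum s ν w v z := by
  have hY : ∀ i j, i < j → pairProd s (x i + z 0 / 2) (x j + z 0 / 2) ≠ 0 := by
    intro i j hij
    rw [pairProd, show x i + z 0 / 2 + (x j + z 0 / 2) = x i + x j + z 0 by ring,
      show x i + z 0 / 2 - (x j + z 0 / 2) = x i - x j by ring]
    exact mul_ne_zero (hx i j hij).1 (hx i j hij).2
  have hN := (razSum_isCubicIn hs ν (hY 0 1 (by decide)) v w (z 0)).sub
    (razSum_isCubicIn hs ν (hY 0 1 (by decide)) w v (z 0))
  have := hs.cubic_eq_zero hY hN (fun i => by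
    rw [show -z 0 / 2 + (x i + z 0 / 2) = x i by ring,
      show -z 0 / 2 - (x i + z 0 / 2) = -z 0 - x i by ring, h i, sub_self]) (z 1 + z 0 / 2)
  have hz' : ![z 0, -z 0 / 2 + (z 1 + z 0 / 2), -z 0 / 2 - (z 1 + z 0 / 2)] = z := by
    rw [Fin.sum_univ_three] at hz
    funext i
    fin_cases i
    · rfl
    · simp; ring
    · simp; linear_combination -hz
  simp only [hz'] at this
  exact sub_eq_zero.mp this

theorem sum_vec_three (a b : ℂ) : ∑ j, ![a, b, -a - b] j = 0 := by
  simp [Fin.sum_univ_three]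

/-- The identity for `z 0 = -(v 0 + w 0)`. -/
theorem razSum_comm_of_semidegenerate (hs : SigmaLike s) (ν : ℂ) {v w z : Fin 3 → ℂ}
    (hv : ∑ j, v j = 0) (hw : ∑ j, w j = 0) (hz : ∑ j, z j = 0)
    (hv' : ∀ j k, j ≠ k → s (v j - v k) ≠ 0) (hw' : ∀ j k, j ≠ k → s (w j - w k) ≠ 0)
    (hvw : ∀ j k l m, j ≠ k → l ≠ m → s (v j - v k + (w l - w m)) ≠ 0)
    (h0 : z 0 = -(v 0 + w 0)) :
    razSum s ν v w z = razSum s ν w v z := by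
  have hv3 := hv
  have hw3 := hw
  simp only [Fin.sum_univ_three] at hv3 hw3
  -- At the first two points `z` is minus a full matching of the `v k` with the `w l`, so every term
  -- contains `s 0`. The last two are the degenerate configuration and its mirror image under `v ↔
  -- w`.
  refine razSum_comm_of_four_points hs ν hz
    ![-(v 1 + w 1), -(v 1 + w 2), -(v 1 + w 0), -(v 0 + w 1)] ?_ ?_
  · intro i j hij
    fin_cases i <;> fin_cases j <;> first | exact absurd hij (by decide) | skip
    all_goals simp only [Fin.isValue, Fin.zero_eta, Fin.mk_one, Fin.reduceFinMk,
      Matrix.cons_val_zero, Matrix.cons_val_one, Matrix.cons_val, h0]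
    · constructor
      · convert hv' 2 1 (by decide) using 2; linear_combination -hv3 - hw3
      · convert hw' 2 1 (by decide) using 2; ring
    · constructor
      · convert hvw 2 1 2 0 (by decide) (by decide) using 2; linear_combination -hv3 - hw3
      · convert hw' 0 1 (by decide) using 2; ring
    · constructor
      · convert hvw 2 0 2 1 (by decide) (by decide) using 2; linear_combination -hv3 - hw3
      · convert hv' 0 1 (by decide) using 2; ring
    · constructor
      · convert hvw 2 1 1 0 (by decide) (by decide) using 2; linear_combination -hv3 - hw3
      · convert hw' 0 2 (by decide) using 2; ring
    · constructor
      · convert hv' 2 0 (by decide) using 2; linear_combination -hv3 - hw3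
      · convert hvw 0 1 1 2 (by decide) (by decide) using 2; ring
    · constructor
      · convert hvw 2 0 2 0 (by decide) (by decide) using 2; linear_combination -hv3 - hw3
      · convert hvw 0 1 1 0 (by decide) (by decide) using 2; ring
  · intro i
    fin_cases i
    all_goals simp only [Fin.isValue, Fin.zero_eta, Fin.mk_one, Fin.reduceFinMk,
      Matrix.cons_val_zero, Matrix.cons_val_one, Matrix.cons_val, h0]
    · rw [razSum_eq_zero, razSum_eq_zero]
      · exact hs
      · intro j
        fin_cases j
        · exact ⟨0, 0, by simp; ring⟩
        · exact ⟨1, 1, by simp; ring⟩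
        · exact ⟨2, 2, by simp; linear_combination hv3 + hw3⟩
      · exact hs
      · intro j
        fin_cases j
        · exact ⟨0, 0, by simp⟩
        · exact ⟨1, 1, by simp⟩
        · exact ⟨2, 2, by simp; linear_combination hv3 + hw3⟩
    · rw [razSum_eq_zero, razSum_eq_zero]
      · exact hs
      · intro j
        fin_cases j
        · exact ⟨0, 0, by simp; ring⟩
        · exact ⟨2, 2, by simp; linear_combination hv3 + hw3⟩
        · exact ⟨1, 1, by simp; ring⟩
      · exact hs
      · intro j
        fin_cases j
        · exact ⟨0, 0, by simp⟩
        · exact ⟨2, 1, by simp⟩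
        · exact ⟨1, 2, by simp; linear_combination hv3 + hw3⟩
    · exact razSum_comm_of_degenerate hs ν hv hw (sum_vec_three _ _) hv' hw' rfl rfl
    · exact (razSum_comm_of_degenerate hs ν hw hv (sum_vec_three _ _) hw' hv'
        (by simp; ring) (by simp; ring)).symm

/-- The identity when one of the `z m` is one of the `-(v k + w l)`. -/
theorem razSum_comm_of_semidegenerate' (hs : SigmaLike s) (ν : ℂ) {v w z : Fin 3 → ℂ}
    (hv : ∑ j, v j = 0) (hw : ∑ j, w j = 0) (hz : ∑ j, z j = 0)
    (hv' : ∀ j k, j ≠ k → s (v j - v k) ≠ 0) (hw' : ∀ j k, j ≠ k → s (w j - w k) ≠ 0)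
    (hvw : ∀ j k l m, j ≠ k → l ≠ m → s (v j - v k + (w l - w m)) ≠ 0)
    (k l m : Fin 3) (h0 : z m = -(v k + w l)) :
    razSum s ν v w z = razSum s ν w v z := by
  have := razSum_comm_of_semidegenerate hs ν (v := v ∘ Equiv.swap 0 k) (w := w ∘ Equiv.swap 0 l)
    (z := z ∘ Equiv.swap 0 m) ((Equiv.sum_comp (Equiv.swap 0 k) v).trans hv)
    ((Equiv.sum_comp (Equiv.swap 0 l) w).trans hw) ((Equiv.sum_comp (Equiv.swap 0 m) z).trans hz)
    (fun i j hij => hv' _ _ (by simpa using hij)) (fun i j hij => hw' _ _ (by simpa using hij))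
    (fun i j a b hij hab => hvw _ _ _ _ (by simpa using hij) (by simpa using hab))
    (by simpa using h0)
  simpa only [razSum_comp_first _ _ _ _ hs, razSum_comp_second, razSum_comp_third] using this

/-- The identity for generic `v`, `w`, `z`. -/
theorem razSum_comm_of_generic (hs : SigmaLike s) (ν : ℂ) {v w z : Fin 3 → ℂ}
    (hv : ∑ j, v j = 0) (hw : ∑ j, w j = 0) (hz : ∑ j, z j = 0)
    (hv' : ∀ j k, j ≠ k → s (v j - v k) ≠ 0) (hw' : ∀ j k, j ≠ k → s (w j - w k) ≠ 0)
    (hvw : ∀ j k l m, j ≠ k → l ≠ m → s (v j - v k + (w l - w m)) ≠ 0)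
    (hvwz : ∀ j k l m, s (z 0 - v j - v k - w l - w m) ≠ 0) :
    razSum s ν v w z = razSum s ν w v z := by
  refine razSum_comm_of_four_points hs ν hz
    ![-(v 0 + w 0), -(v 0 + w 1), -(v 1 + w 0), -(v 1 + w 1)] ?_ ?_
  · intro i j hij
    fin_cases i <;> fin_cases j <;> first | exact absurd hij (by decide) | skip
    all_goals simp only [Fin.isValue, Fin.zero_eta, Fin.mk_one, Fin.reduceFinMk,
      Matrix.cons_val_zero, Matrix.cons_val_one, Matrix.cons_val]
    · constructor
      · convert hvwz 0 0 0 1 using 2; ring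
      · convert hw' 1 0 (by decide) using 2; ring
    · constructor
      · convert hvwz 0 1 0 0 using 2; ring
      · convert hv' 1 0 (by decide) using 2; ring
    · constructor
      · convert hvwz 0 1 0 1 using 2; ring
      · convert hvw 1 0 1 0 (by decide) (by decide) using 2; ring
    · constructor
      · convert hvwz 0 1 0 1 using 2; ring
      · convert hvw 1 0 0 1 (by decide) (by decide) using 2; ring
    · constructor
      · convert hvwz 0 1 1 1 using 2; ring
      · convert hv' 1 0 (by decide) using 2; ring
    · constructor
      · convert hvwz 1 1 0 1 using 2; ring
      · convert hw' 1 0 (by decide) using 2; ring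
  · intro i
    fin_cases i
    · exact razSum_comm_of_semidegenerate' hs ν hv hw (sum_vec_three _ _) hv' hw' hvw 0 0 1 rfl
    · exact razSum_comm_of_semidegenerate' hs ν hv hw (sum_vec_three _ _) hv' hw' hvw 0 1 1 rfl
    · exact razSum_comm_of_semidegenerate' hs ν hv hw (sum_vec_three _ _) hv' hw' hvw 1 0 1 rfl
    · exact razSum_comm_of_semidegenerate' hs ν hv hw (sum_vec_three _ _) hv' hw' hvw 1 1 1 rfl

end identity

/-! ### Removing genericity by continuity -/

section density

variable {s : ℂ → ℂ}

open MeasureTheory in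
theorem ae_affine_ne_zero (h0 : {x | s x = 0}.Countable) (α : ℂ) {β : ℤ} (hβ : β ≠ 0) :
    ∀ᵐ t : ℂ, s (α + t * β) ≠ 0 := by
  have hinj : Function.Injective fun t : ℂ => α + t * β := by
    intro a b hab
    simpa [hβ] using hab
  exact (h0.preimage hinj).ae_notMem volume

theorem continuousAt_razSum (hc : Continuous s) (ν : ℂ) {v w z : ℂ → Fin 3 → ℂ}
    (hv : Continuous v) (hw : Continuous w) (hz : Continuous z) {t : ℂ}
    (h : ∀ j k, j ≠ k → s (v t j - v t k) ≠ 0) :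
    ContinuousAt (fun t => razSum s ν (v t) (w t) (z t)) t := by
  have hv' : ∀ j, Continuous fun t => v t j := fun j => (continuous_apply j).comp hv
  have hw' : ∀ j, Continuous fun t => w t j := fun j => (continuous_apply j).comp hw
  have hz' : ∀ j, Continuous fun t => z t j := fun j => (continuous_apply j).comp hz
  unfold razSum razTerm
  refine tendsto_finsetSum _ fun j _ => ?_
  refine ContinuousAt.mul (ContinuousAt.div ?_ ?_ ?_) ?_
  · have := hv' (j + 1)
    have := hv' (j + 2)
    fun_prop
  · have := hv' j
    have := hv' (j + 1)
    have := hv' (j + 2)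
    fun_prop
  · exact mul_ne_zero (h _ _ (by revert j; decide)) (h _ _ (by revert j; decide))
  · have := hv' j
    refine Continuous.continuousAt (continuous_finsetProd _ fun l _ =>
      continuous_finsetProd _ fun m _ => ?_)
    have := hw' l
    have := hz' m
    fun_prop

open MeasureTheory in
/-- The symmetry of `razSum`, for a continuous function with countably many zeros. -/
theorem razSum_comm (hs : SigmaLike s) (hc : Continuous s) (h0 : {x | s x = 0}.Countable) (ν : ℂ)
    {v w z : Fin 3 → ℂ} (hv : ∑ j, v j = 0) (hw : ∑ j, w j = 0) (hz : ∑ j, z j = 0)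
    (hv' : ∀ j k, j ≠ k → s (v j - v k) ≠ 0) (hw' : ∀ j k, j ≠ k → s (w j - w k) ≠ 0) :
    razSum s ν v w z = razSum s ν w v z := by
  -- The direction has sum zero, so the constraints persist. The entries are distinct and the
  -- weights 1, 5, 100 far enough apart that no excluded combination is constant in `t`.
  let d : Fin 3 → ℤ := ![1, -1, 0]
  let V : ℂ → Fin 3 → ℂ := fun t j => v j + t * d j
  let W : ℂ → Fin 3 → ℂ := fun t j => w j + t * (5 * d j : ℤ)
  let Z : ℂ → Fin 3 → ℂ := fun t j => z j + t * (100 * d j : ℤ)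
  have hV : Continuous V := by fun_prop
  have hW : Continuous W := by fun_prop
  have hZ : Continuous Z := by fun_prop
  have e1 : ∀ᵐ t : ℂ, ∀ j k, j ≠ k → s (V t j - V t k) ≠ 0 := by
    simp only [ae_all_iff]
    intro j k hjk
    have hd : d j - d k ≠ 0 := by revert j k; decide
    filter_upwards [ae_affine_ne_zero h0 (v j - v k) hd] with t ht
    convert ht using 2
    simp only [V]; push_cast; ring
  have e2 : ∀ᵐ t : ℂ, ∀ j k, j ≠ k → s (W t j - W t k) ≠ 0 := by
    simp only [ae_all_iff]
    intro j k hjk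
    have hd : 5 * d j - 5 * d k ≠ 0 := by revert j k; decide
    filter_upwards [ae_affine_ne_zero h0 (w j - w k) hd] with t ht
    convert ht using 2
    simp only [W]; push_cast; ring
  have e3 : ∀ᵐ t : ℂ, ∀ j k l m, j ≠ k → l ≠ m → s (V t j - V t k + (W t l - W t m)) ≠ 0 := by
    simp only [ae_all_iff]
    intro j k l m hjk hlm
    have hd : d j - d k + (5 * d l - 5 * d m) ≠ 0 := by revert j k l m; decide
    filter_upwards [ae_affine_ne_zero h0 (v j - v k + (w l - w m)) hd] with t ht
    convert ht using 2
    simp only [V, W]; push_cast; ring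
  have e4 : ∀ᵐ t : ℂ, ∀ j k l m, s (Z t 0 - V t j - V t k - W t l - W t m) ≠ 0 := by
    simp only [ae_all_iff]
    intro j k l m
    have hd : 100 * d 0 - d j - d k - 5 * d l - 5 * d m ≠ 0 := by revert j k l m; decide
    filter_upwards [ae_affine_ne_zero h0 (z 0 - v j - v k - w l - w m) hd] with t ht
    convert ht using 2
    simp only [V, W, Z]; push_cast; ring
  have hae : ∀ᵐ t : ℂ, razSum s ν (V t) (W t) (Z t) - razSum s ν (W t) (V t) (Z t) = 0 := by
    filter_upwards [e1, e2, e3, e4] with t h1 h2 h3 h4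
    refine sub_eq_zero.mpr (razSum_comm_of_generic hs ν ?_ ?_ ?_ h1 h2 h3 h4)
    · simp only [Fin.sum_univ_three] at hv ⊢
      simp [V, d]; linear_combination hv
    · simp only [Fin.sum_univ_three] at hw ⊢
      simp [W, d]; linear_combination hw
    · simp only [Fin.sum_univ_three] at hz ⊢
      simp [Z, d]; linear_combination hz
  have V0 : V 0 = v := by funext j; simp [V]
  have W0 : W 0 = w := by funext j; simp [W]
  have Z0 : Z 0 = z := by funext j; simp [Z]
  have hcont : ContinuousAt
      (fun t => razSum s ν (V t) (W t) (Z t) - razSum s ν (W t) (V t) (Z t)) 0 :=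
    (continuousAt_razSum hc ν hV hW hZ (by rwa [V0])).sub
      (continuousAt_razSum hc ν hW hV hZ (by rwa [W0]))
  by_contra hne
  have hne' : ∀ᶠ t in nhds (0 : ℂ),
      razSum s ν (V t) (W t) (Z t) - razSum s ν (W t) (V t) (Z t) ≠ 0 := by
    refine hcont.eventually_ne ?_
    rw [V0, W0, Z0]
    exact sub_ne_zero.mpr hne
  obtain ⟨t, ht, ht'⟩ := (Measure.dense_of_ae hae).inter_nhds_nonempty hne'
  exact ht' ht

end density

/-! ### Fourier coefficients of degree-two theta functions -/

section quasiperiodic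

/-- An entire function with real period `T` and multiplier of degree two in an imaginary direction
vanishes as soon as two consecutive Fourier coefficients vanish. -/
theorem eq_zero_of_quasiperiodic {f : ℂ → ℂ} (hf : Differentiable ℂ f) {T a : ℝ} (hT : 0 < T)
    {C : ℂ} (hC : C ≠ 0) (hper : ∀ x, f (x + T) = f x)
    (hq : ∀ x, f (x + a * I) = C * exp (2 * Real.pi * I * (-2) * x / T) * f x)
    (h0 : ∫ x : ℝ in 0..T, f x = 0)
    (h1 : ∫ x : ℝ in 0..T, exp (2 * Real.pi * I * (-1) * x / T) * f x = 0) (x : ℂ) : f x = 0 := by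
  have hT' : (T : ℂ) ≠ 0 := by exact_mod_cast hT.ne'
  let c : ℤ → ℂ := fun n => ∫ x : ℝ in 0..T, exp (2 * Real.pi * I * (-n : ℤ) * x / T) * f x
  -- Cauchy's theorem on the rectangle with sides `T` and `a`: the vertical sides cancel by
  -- periodicity, and the multiplier on the top side shifts the index by two.
  have hrec : ∀ n, c n = exp (2 * Real.pi * I * (-n : ℤ) * (a * I) / T) * C * c (n + 2) := by
    intro n
    let g : ℂ → ℂ := fun x => exp (2 * Real.pi * I * (-n : ℤ) * x / T) * f x
    have hg : Differentiable ℂ g := by fun_prop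
    have hgper : ∀ x, g (x + T) = g x := by
      intro x
      simp only [g, hper]
      rw [show 2 * Real.pi * I * (-n : ℤ) * (x + T) / T =
        2 * Real.pi * I * (-n : ℤ) * x / T + (-n : ℤ) * (2 * Real.pi * I) by field_simp,
        exp_add, exp_int_mul_two_pi_mul_I, mul_one]
    have := integral_boundary_rect_eq_zero_of_differentiableOn g 0 (T + a * I) hg.differentiableOn
    simp only [zero_re, zero_im, add_re, ofReal_re, mul_re, I_re, mul_zero, ofReal_im, I_im,
      mul_one, sub_self, add_zero, add_im, mul_im, zero_add, ofReal_zero, zero_mul] at this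
    have e : ∀ y : ℝ, g (T + y * I) = g (y * I) := fun y => by rw [add_comm, hgper]
    simp only [e] at this
    have e2 : ∀ x : ℝ, g (x + a * I) = exp (2 * Real.pi * I * (-n : ℤ) * (a * I) / T) * C *
        (exp (2 * Real.pi * I * (-(n + 2) : ℤ) * x / T) * f x) := by
      intro x
      simp only [g, hq]
      rw [show exp (2 * Real.pi * I * (-n : ℤ) * (x + a * I) / T) *
        (C * exp (2 * Real.pi * I * (-2) * x / T) * f x) =
        (exp (2 * Real.pi * I * (-n : ℤ) * (x + a * I) / T) *
          exp (2 * Real.pi * I * (-2) * x / T)) * (C * f x) by ring, ← exp_add,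
        show exp (2 * Real.pi * I * (-n : ℤ) * (a * I) / T) * C *
        (exp (2 * Real.pi * I * (-(n + 2) : ℤ) * x / T) * f x) =
        (exp (2 * Real.pi * I * (-n : ℤ) * (a * I) / T) *
          exp (2 * Real.pi * I * (-(n + 2) : ℤ) * x / T)) * (C * f x) by ring, ← exp_add]
      congr 2
      push_cast
      ring
    simp only [e2, intervalIntegral.integral_const_mul] at this
    change c n - _ * c (n + 2) + _ - _ = 0 at this
    linear_combination this
  have hup : ∀ n, c n = 0 → c (n + 2) = 0 := by
    intro n hn
    rw [hrec n] at hn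
    simpa [hC, exp_ne_zero] using hn
  have hdown : ∀ n, c (n + 2) = 0 → c n = 0 := by
    intro n hn
    rw [hrec n, hn, mul_zero]
  have c0 : c 0 = 0 := by simpa [c] using h0
  have c1 : c 1 = 0 := by simpa [c] using h1
  have hpos : ∀ n : ℕ, c n = 0 ∧ c (n + 1) = 0 := by
    intro n
    induction n with
    | zero => exact ⟨c0, by simpa using c1⟩
    | succ n ih =>
      push_cast
      exact ⟨ih.2, by rw [add_assoc]; exact hup _ ih.1⟩
  have hneg : ∀ n : ℕ, c (-n) = 0 ∧ c (-n + 1) = 0 := by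
    intro n
    induction n with
    | zero => exact ⟨c0, by simpa using c1⟩
    | succ n ih =>
      push_cast
      refine ⟨hdown _ ?_, ?_⟩
      · rw [show -((n : ℤ) + 1) + 2 = -n + 1 by ring]; exact ih.2
      · rw [show -((n : ℤ) + 1) + 1 = -n by ring]; exact ih.1
  have hall : ∀ n : ℤ, c n = 0 := by
    intro n
    obtain ⟨m, rfl | rfl⟩ := n.eq_nat_or_neg
    · exact (hpos m).1
    · exact (hneg m).1
  have : Fact (0 < T) := ⟨hT⟩
  have hperR : Function.Periodic (fun x : ℝ => f x) T := by
    intro x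
    simp only [ofReal_add, hper]
  let F : C(AddCircle T, ℂ) := ⟨hperR.lift, by
    exact continuous_coinduced_dom.mpr (hf.continuous.comp continuous_ofReal)⟩
  have hF : ∀ n, fourierCoeff F n = 0 := by
    intro n
    rw [fourierCoeff_eq_intervalIntegral _ n 0]
    have : ∀ x : ℝ, @fourier T (-n) x • F x = exp (2 * Real.pi * I * (-n : ℤ) * x / T) * f x := by
      intro x
      rw [fourier_coe_apply]
      rfl
    simp only [this, zero_add]
    change _ • c n = 0
    rw [hall, smul_zero]
  have hF0 : ∀ x : ℝ, f x = 0 := by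
    intro x
    have hsum : Summable (fourierCoeff F) := by
      rw [show fourierCoeff F = fun _ => 0 from funext hF]
      exact summable_zero
    have := has_pointwise_sum_fourier_series_of_summable hsum (x : AddCircle T)
    simp only [hF, zero_smul] at this
    exact this.unique hasSum_zero
  have hfr : ∃ᶠ x in nhdsWithin (0 : ℂ) {0}ᶜ, f x = (fun _ => (0 : ℂ)) x := by
    have ht : Filter.Tendsto (fun x : ℝ => (x : ℂ)) (nhdsWithin 0 {0}ᶜ)
        (nhdsWithin (0 : ℂ) {0}ᶜ) := by
      refine tendsto_nhdsWithin_iff.mpr ⟨?_, ?_⟩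
      · exact (continuous_ofReal.tendsto' (0 : ℝ) (0 : ℂ) ofReal_zero).mono_left
          nhdsWithin_le_nhds
      · filter_upwards [self_mem_nhdsWithin] with y hy
        simpa using hy
    exact ht.frequently (Filter.Eventually.frequently (.of_forall hF0))
  have := AnalyticOnNhd.eq_of_frequently_eq (fun z _ => hf.analyticAt z)
    (fun z _ => analyticAt_const) hfr
  exact congrFun this x

end quasiperiodic

/-! ### The odd theta function and the three-term identity -/

section theta

/-- The infinite product `∏ (1 - X q ^ k)`. -/
def qPoch (q X : ℂ) : ℂ := ∏' k : ℕ, (1 - X * q ^ k)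

variable {q : ℂ}

theorem summable_qPoch (hq : ‖q‖ < 1) (X : ℂ) : Summable fun k : ℕ => ‖-(X * q ^ k)‖ := by
  simp only [norm_neg, norm_mul, norm_pow]
  exact (summable_geometric_of_lt_one (norm_nonneg _) hq).mul_left _

theorem multipliable_qPoch (hq : ‖q‖ < 1) (X : ℂ) : Multipliable fun k : ℕ => 1 - X * q ^ k := by
  simpa only [sub_eq_add_neg] using multipliable_one_add_of_summable (summable_qPoch hq X)

theorem qPoch_eq_mul (hq : ‖q‖ < 1) (X : ℂ) : qPoch q X = (1 - X) * qPoch q (X * q) := by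
  have h : ∀ k : ℕ, 1 - X * q ^ (k + 1) = 1 - X * q * q ^ k := fun k => by ring
  rw [qPoch, tprod_eq_zero_mul' (by simpa only [h] using multipliable_qPoch hq (X * q))]
  simp only [h, pow_zero, mul_one, qPoch]

theorem differentiable_qPoch (hq : ‖q‖ < 1) : Differentiable ℂ (qPoch q) := by
  intro X
  have h : HasProdLocallyUniformlyOn (fun (k : ℕ) (X : ℂ) => 1 + -(X * q ^ k))
      (fun X => ∏' k : ℕ, (1 + -(X * q ^ k))) (Metric.ball 0 (‖X‖ + 1)) := by
    refine Summable.hasProdLocallyUniformlyOn_nat_one_add Metric.isOpen_ball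
      ((summable_geometric_of_lt_one (norm_nonneg _) hq).mul_left (‖X‖ + 1))
      (.of_forall fun k Y hY => ?_) (fun k => by fun_prop)
    rw [norm_neg, norm_mul, norm_pow]
    have : ‖Y‖ ≤ ‖X‖ + 1 := by simpa using (mem_ball_zero_iff.mp hY).le
    gcongr
  have hd := h.differentiableOn (.of_forall fun _ => by
    simpa [Finset.prod_fn] using DifferentiableOn.finsetProd (fun _ _ => by fun_prop))
    Metric.isOpen_ball
  have e : qPoch q = fun X => ∏' k : ℕ, (1 + -(X * q ^ k)) := by
    funext X
    simp only [qPoch, sub_eq_add_neg]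
  rw [e]
  exact hd.differentiableAt (Metric.isOpen_ball.mem_nhds (by simp))

variable {r α : ℝ}

theorem norm_exp_lt_one (hr : 0 < r) (hα : 0 < α) : ‖exp (-2 * α * r)‖ < 1 := by
  rw [norm_exp, show (-2 * (α : ℂ) * r) = ((-2 * α * r : ℝ) : ℂ) by push_cast; ring, ofReal_re,
    Real.exp_lt_one_iff]
  nlinarith [mul_pos hr hα]

theorem R_eq_qPoch (hr : 0 < r) (hα : 0 < α) (z : ℂ) :
    R r α z = qPoch (exp (-2 * α * r)) (exp (2 * I * r * z - α * r)) *
      qPoch (exp (-2 * α * r)) (exp (-2 * I * r * z - α * r)) := by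
  have hq := norm_exp_lt_one hr hα
  rw [qPoch, qPoch, ← (multipliable_qPoch hq _).tprod_mul (multipliable_qPoch hq _), R]
  refine tprod_congr fun k => ?_
  rw [← exp_nat_mul, ← exp_add, ← exp_add]
  congr 3 <;> ring

/-- The odd theta function attached to `R`. -/
def sigma (r α : ℝ) (x : ℂ) : ℂ := exp (-I * r * x) * R r α (x - I * α / 2)

theorem sigma_eq_qPoch (hr : 0 < r) (hα : 0 < α) (x : ℂ) :
    sigma r α x = exp (-I * r * x) * (qPoch (exp (-2 * α * r)) (exp (2 * I * r * x)) *
      qPoch (exp (-2 * α * r)) (exp (-2 * I * r * x) * exp (-2 * α * r))) := by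
  rw [sigma, R_eq_qPoch hr hα, ← exp_add]
  congr 4
  · linear_combination (-r * α : ℂ) * I_sq
  · linear_combination (r * α : ℂ) * I_sq

theorem sigma_neg (hr : 0 < r) (hα : 0 < α) (x : ℂ) : sigma r α (-x) = -sigma r α x := by
  have hq := norm_exp_lt_one hr hα
  rw [sigma_eq_qPoch hr hα, sigma_eq_qPoch hr hα, mul_neg, mul_neg, mul_neg,
    qPoch_eq_mul hq (exp (2 * I * r * x)), qPoch_eq_mul hq (exp (-(2 * I * r * x)))]
  have e : exp (-2 * I * r * x) = exp (-(2 * I * r * x)) := by ring_nf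
  have e' : exp (-(-2 * I * r * x)) = exp (2 * I * r * x) := by ring_nf
  have e1 : exp (-(-I * r * x)) * exp (-(2 * I * r * x)) = exp (-I * r * x) := by
    rw [← exp_add]; ring_nf
  have e2 : exp (-I * r * x) * exp (2 * I * r * x) = exp (-(-I * r * x)) := by
    rw [← exp_add]; ring_nf
  rw [e, e']
  linear_combination (-(qPoch (exp (-2 * α * r)) (exp (-(2 * I * r * x)) * exp (-2 * α * r)) *
    qPoch (exp (-2 * α * r)) (exp (2 * I * r * x) * exp (-2 * α * r)))) * (e1 + e2)

theorem sigma_add_period (hr : 0 < r) (hα : 0 < α) (x : ℂ) :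
    sigma r α (x + (Real.pi / r : ℝ)) = -sigma r α x := by
  have hr' : (r : ℂ) ≠ 0 := by exact_mod_cast hr.ne'
  rw [sigma_eq_qPoch hr hα, sigma_eq_qPoch hr hα]
  have e1 : exp (-I * r * (x + (Real.pi / r : ℝ))) = -exp (-I * r * x) := by
    rw [show -I * r * (x + (Real.pi / r : ℝ)) = -I * r * x - Real.pi * I by
      push_cast; field_simp; ring, exp_sub_pi_mul_I]
  have e2 : exp (2 * I * r * (x + (Real.pi / r : ℝ))) = exp (2 * I * r * x) := by
    rw [show 2 * I * r * (x + (Real.pi / r : ℝ)) = 2 * I * r * x + 2 * Real.pi * I by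
      push_cast; field_simp, exp_add, exp_two_pi_mul_I, mul_one]
  have e3 : exp (-2 * I * r * (x + (Real.pi / r : ℝ))) = exp (-2 * I * r * x) := by
    rw [show -2 * I * r * (x + (Real.pi / r : ℝ)) = -2 * I * r * x - 2 * Real.pi * I by
      push_cast; field_simp; ring, exp_sub, exp_two_pi_mul_I, div_one]
  rw [e1, e2, e3, neg_mul]

/-- With `X = exp (2irx)`, one product loses the factor `1 - X` and the other gains `1 - X⁻¹`; their
ratio is `-X⁻¹`. -/
theorem sigma_add_quasiperiod (hr : 0 < r) (hα : 0 < α) (x : ℂ) :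
    sigma r α (x + α * I) = -(exp (α * r) * exp (-2 * I * r * x)) * sigma r α x := by
  have hq := norm_exp_lt_one hr hα
  have e1 : exp (-I * r * (x + α * I)) = exp (α * r) * exp (-I * r * x) := by
    rw [← exp_add]; congr 1; linear_combination (-r * α : ℂ) * I_sq
  have e2 : exp (2 * I * r * (x + α * I)) = exp (2 * I * r * x) * exp (-2 * α * r) := by
    rw [← exp_add]; congr 1; linear_combination (2 * r * α : ℂ) * I_sq
  have e3 : exp (-2 * I * r * (x + α * I)) * exp (-2 * α * r) = exp (-2 * I * r * x) := by
    rw [← exp_add]; congr 1; linear_combination (-2 * r * α : ℂ) * I_sq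
  have e4 : exp (-2 * I * r * x) * exp (2 * I * r * x) = 1 := by
    rw [← exp_add]; ring_nf; exact exp_zero
  rw [sigma_eq_qPoch hr hα, sigma_eq_qPoch hr hα, e1, e2, e3,
    qPoch_eq_mul hq (exp (2 * I * r * x)), qPoch_eq_mul hq (exp (-2 * I * r * x))]
  linear_combination (-(exp (α * r) * exp (-I * r * x) *
    qPoch (exp (-2 * α * r)) (exp (2 * I * r * x) * exp (-2 * α * r)) *
    qPoch (exp (-2 * α * r)) (exp (-2 * I * r * x) * exp (-2 * α * r)))) * e4

theorem differentiable_sigma (hr : 0 < r) (hα : 0 < α) : Differentiable ℂ (sigma r α) := by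
  have hd := differentiable_qPoch (norm_exp_lt_one hr hα)
  rw [show sigma r α = _ from funext (sigma_eq_qPoch hr hα)]
  fun_prop

theorem countable_sigma_zeros (hr : 0 < r) (hα : 0 < α) {x₀ : ℂ} (hx₀ : sigma r α x₀ ≠ 0) :
    {x | sigma r α x = 0}.Countable := by
  have h := AnalyticOnNhd.preimage_zero_mem_codiscrete
    (fun z _ => (differentiable_sigma hr hα).analyticAt z) hx₀
  have hd := (mem_codiscrete'.mp h).2
  have e : (sigma r α ⁻¹' {0}ᶜ)ᶜ = {x | sigma r α x = 0} := by ext; simp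
  rw [e] at hd
  exact (HereditarilyLindelofSpace.isLindelof _).countable_of_isDiscrete hd

/-- The three-term identity of Weierstrass, in the form of a Plücker relation. -/
theorem sigmaLike_sigma (hr : 0 < r) (hα : 0 < α) : SigmaLike (sigma r α) := by
  refine ⟨sigma_neg hr hα, fun x y z w => ?_⟩
  set s := sigma r α with hs
  change pairProd s x y * pairProd s z w - pairProd s x z * pairProd s y w +
    pairProd s x w * pairProd s y z = 0
  have hswap : ∀ x y, pairProd s x y = -pairProd s y x := by
    intro x y
    rw [pairProd, pairProd, ← neg_sub y x, add_comm x y, hs, sigma_neg hr hα]; ring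
  have hself : ∀ x, pairProd s x x = 0 := fun x => by linear_combination hswap x x / 2
  have hd : ∀ y, Differentiable ℂ fun x => pairProd s x y := by
    intro y
    have := differentiable_sigma hr hα
    unfold pairProd
    fun_prop
  have hr' : (r : ℂ) ≠ 0 := by exact_mod_cast hr.ne'
  have hpi : (Real.pi : ℂ) ≠ 0 := by exact_mod_cast Real.pi_ne_zero
  have hper : ∀ y x, pairProd s (x + (Real.pi / r : ℝ)) y = pairProd s x y := by
    intro y x
    rw [pairProd, pairProd, add_right_comm, add_sub_right_comm, hs, sigma_add_period hr hα,
      sigma_add_period hr hα]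
    ring
  have hquasi : ∀ y x, pairProd s (x + α * I) y = exp (2 * α * r) *
      exp (2 * Real.pi * I * (-2) * x / (Real.pi / r : ℝ)) * pairProd s x y := by
    intro y x
    have e1 : exp (α * r) * exp (α * r) = exp (2 * α * r) := by rw [← exp_add]; ring_nf
    have e2 : exp (-2 * I * r * (x + y)) * exp (-2 * I * r * (x - y)) =
        exp (2 * Real.pi * I * (-2) * x / (Real.pi / r : ℝ)) := by
      rw [← exp_add]
      congr 1
      push_cast
      field_simp
      ring
    rw [pairProd, pairProd, add_right_comm, add_sub_right_comm, hs, sigma_add_quasiperiod hr hα,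
      sigma_add_quasiperiod hr hα, ← e1, ← e2]
    ring
  let T : ℝ := Real.pi / r
  let Y : Fin 3 → ℂ := ![y, z, w]
  -- Two Fourier coefficients of three functions: a kernel vector gives a combination with both
  -- coefficients zero, hence identically zero.
  let M : Matrix (Fin 2) (Fin 3) ℂ := fun i k =>
    ∫ x : ℝ in 0..T, exp (2 * Real.pi * I * (-(i : ℕ)) * x / T) * pairProd s x (Y k)
  obtain ⟨c, hc, hc0⟩ := Submodule.exists_mem_ne_zero_of_ne_bot
    (LinearMap.ker_ne_bot_of_finrank_lt (f := Matrix.toLin' M) (by simp))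
  have hMc : M.mulVec c = 0 := by simpa using hc
  let f : ℂ → ℂ := fun x => ∑ k, c k * pairProd s x (Y k)
  have hfd : Differentiable ℂ f := by
    have := hd
    fun_prop
  have hcoef : ∀ i : Fin 2,
      ∫ x : ℝ in 0..T, exp (2 * Real.pi * I * (-(i : ℕ)) * x / T) * f x = 0 := by
    intro i
    have h := congrFun hMc i
    simp only [Matrix.mulVec, dotProduct, M, Pi.zero_apply] at h
    rw [← h]
    simp only [← intervalIntegral.integral_mul_const]
    rw [← intervalIntegral.integral_finsetSum]
    · refine intervalIntegral.integral_congr fun x _ => ?_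
      simp only [f, Finset.mul_sum]
      exact Finset.sum_congr rfl fun k _ => by ring
    · intro k _
      have := (hd (Y k)).continuous
      exact Continuous.intervalIntegrable (by fun_prop) _ _
  have hf0 : ∀ x, f x = 0 := by
    refine eq_zero_of_quasiperiodic hfd (T := T) (a := α) (C := exp (2 * α * r))
      (div_pos Real.pi_pos hr) (exp_ne_zero _) ?_ ?_ (by simpa using hcoef 0) (by simpa using hcoef 1)
    · intro x
      simp only [f, T, hper]
    · intro x
      simp only [f, T, hquasi, Finset.mul_sum]
      exact Finset.sum_congr rfl fun k _ => by ring
  simp only [f, Fin.sum_univ_three, Y, Matrix.cons_val_zero, Matrix.cons_val_one,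
    Matrix.cons_val] at hf0
  have kx := hf0 x
  have ky := hf0 y
  have kz := hf0 z
  have kw := hf0 w
  simp only [hself] at ky kz kw
  rw [hswap z y] at kz
  rw [hswap w y, hswap w z] at kw
  obtain ⟨k, hk⟩ := Function.ne_iff.mp hc0
  rw [Pi.zero_apply] at hk
  -- For each `k`, the relations at `x` and at the two points other than `Y k` eliminate all but `c
  -- k` times the Plücker expression.
  refine (mul_eq_zero.mp ?_).resolve_left hk
  fin_cases k
  · simp only [Fin.zero_eta]
    linear_combination pairProd s z w * kx + pairProd s x z * kw - pairProd s x w * kz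
  · simp only [Fin.mk_one]
    linear_combination -pairProd s y w * kx - pairProd s x y * kw + pairProd s x w * ky
  · simp only [Fin.reduceFinMk]
    linear_combination pairProd s y z * kx + pairProd s x y * kz - pairProd s x z * ky

end theta

/-! ### The elliptic gamma function and its difference equation -/

section gamma

/-- The double infinite product `∏ (1 - X p ^ m q ^ n)`. -/
def qqPoch (p q X : ℂ) : ℂ := ∏' k : ℕ × ℕ, (1 - X * p ^ k.1 * q ^ k.2)

variable {p q : ℂ}

theorem summable_qqPoch (hp : ‖p‖ < 1) (hq : ‖q‖ < 1) (X : ℂ) :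
    Summable fun k : ℕ × ℕ => ‖-(X * p ^ k.1 * q ^ k.2)‖ := by
  simp only [norm_neg, norm_mul, norm_pow, mul_assoc]
  exact ((summable_geometric_of_lt_one (norm_nonneg _) hp).mul_of_nonneg
    (summable_geometric_of_lt_one (norm_nonneg _) hq) (fun _ => by positivity)
    (fun _ => by positivity)).mul_left _

theorem multipliable_qqPoch (hp : ‖p‖ < 1) (hq : ‖q‖ < 1) (X : ℂ) :
    Multipliable fun k : ℕ × ℕ => 1 - X * p ^ k.1 * q ^ k.2 := by
  simpa only [sub_eq_add_neg] using multipliable_one_add_of_summable (summable_qqPoch hp hq X)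

theorem qqPoch_ne_zero (hp : ‖p‖ < 1) (hq : ‖q‖ < 1) {X : ℂ}
    (h : ∀ m n : ℕ, 1 - X * p ^ m * q ^ n ≠ 0) : qqPoch p q X ≠ 0 := by
  have := tprod_one_add_ne_zero_of_summable (f := fun k : ℕ × ℕ => -(X * p ^ k.1 * q ^ k.2))
    (fun k => by simpa only [sub_eq_add_neg] using h k.1 k.2) (summable_qqPoch hp hq X)
  simpa only [qqPoch, sub_eq_add_neg] using this

theorem hasProd_qqPoch (hp : ‖p‖ < 1) (hq : ‖q‖ < 1) (X : ℂ) :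
    HasProd (fun n : ℕ => qPoch p (X * q ^ n)) (qqPoch p q X) := by
  have h := (Equiv.hasProd_iff (Equiv.prodComm ℕ ℕ)).mpr (multipliable_qqPoch hp hq X).hasProd
  refine h.prod_fiberwise fun n => ?_
  have := (multipliable_qPoch hp (X * q ^ n)).hasProd
  refine (congrArg (fun f => HasProd f (qPoch p (X * q ^ n))) (funext fun k => ?_)).mp this
  simp only [Function.comp_apply, Equiv.prodComm_apply, Prod.swap_prod_mk]
  ring

theorem qqPoch_eq_mul (hp : ‖p‖ < 1) (hq : ‖q‖ < 1) (X : ℂ) :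
    qqPoch p q X = qPoch p X * qqPoch p q (X * q) := by
  have e : ∀ n : ℕ, X * q ^ (n + 1) = X * q * q ^ n := fun n => by ring
  have h := hasProd_qqPoch hp hq (X * q)
  rw [← (hasProd_qqPoch hp hq X).tprod_eq, ← h.tprod_eq,
    tprod_eq_zero_mul' (by simpa only [e] using h.multipliable)]
  simp only [e, pow_zero, mul_one]

variable {r ap am : ℝ}

theorem exp_mul_pow_mul_pow (r ap am : ℝ) (x : ℂ) (m n : ℕ) :
    exp (-(2 * m + 1) * r * ap - (2 * n + 1) * r * am + x) =
      exp (-r * ap - r * am + x) * exp (-2 * ap * r) ^ m * exp (-2 * am * r) ^ n := by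
  rw [← exp_nat_mul, ← exp_nat_mul, ← exp_add, ← exp_add]
  congr 1
  ring

theorem qqPoch_ne_zero_of_GRegular (hr : 0 < r) (hap : 0 < ap) (ham : 0 < am) {z : ℂ}
    (h : GRegular r ap am z) :
    qqPoch (exp (-2 * ap * r)) (exp (-2 * am * r)) (exp (-r * ap - r * am + 2 * I * r * z)) ≠ 0 :=
  qqPoch_ne_zero (norm_exp_lt_one hr hap) (norm_exp_lt_one hr ham) fun m n => by
    rw [← exp_mul_pow_mul_pow]; exact h m n

theorem G_eq_qqPoch (hr : 0 < r) (hap : 0 < ap) (ham : 0 < am) {z : ℂ}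
    (h : qqPoch (exp (-2 * ap * r)) (exp (-2 * am * r))
      (exp (-r * ap - r * am + 2 * I * r * z)) ≠ 0) :
    G r ap am z =
      qqPoch (exp (-2 * ap * r)) (exp (-2 * am * r)) (exp (-r * ap - r * am + -2 * I * r * z)) /
      qqPoch (exp (-2 * ap * r)) (exp (-2 * am * r)) (exp (-r * ap - r * am + 2 * I * r * z)) := by
  have hp := norm_exp_lt_one hr hap
  have hq := norm_exp_lt_one hr ham
  rw [qqPoch, qqPoch, ← Multipliable.tprod_div₀ (multipliable_qqPoch hp hq _)
    (multipliable_qqPoch hp hq _) h, G]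
  refine tprod_congr fun k => ?_
  rw [← exp_mul_pow_mul_pow, ← exp_mul_pow_mul_pow]
  congr 3
  ring_nf

/-- The shift removes one row of the double product in the denominator and adds one in the
numerator; the two rows form `R`. The new denominator divides the old one, so regularity at `u`
suffices. -/
theorem G_add (hr : 0 < r) (hap : 0 < ap) (ham : 0 < am) {u : ℂ} (h : GRegular r ap am u) :
    G r ap am (u + I * am) = R r ap (u + I * am / 2) * G r ap am u := by
  have hp := norm_exp_lt_one hr hap
  have hq := norm_exp_lt_one hr ham
  have h1 := qqPoch_ne_zero_of_GRegular hr hap ham h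
  have e1 : exp (-r * ap - r * am + 2 * I * r * (u + I * am)) =
      exp (-r * ap - r * am + 2 * I * r * u) * exp (-2 * am * r) := by
    rw [← exp_add]; congr 1; linear_combination (2 * r * am : ℂ) * I_sq
  have e2 : exp (-r * ap - r * am + -2 * I * r * (u + I * am)) * exp (-2 * am * r) =
      exp (-r * ap - r * am + -2 * I * r * u) := by
    rw [← exp_add]; congr 1; linear_combination (-2 * r * am : ℂ) * I_sq
  have e3 : exp (2 * I * r * (u + I * am / 2) - ap * r) =
      exp (-r * ap - r * am + 2 * I * r * u) := by
    congr 1; linear_combination (r * am : ℂ) * I_sq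
  have e4 : exp (-2 * I * r * (u + I * am / 2) - ap * r) =
      exp (-r * ap - r * am + -2 * I * r * (u + I * am)) := by
    congr 1; linear_combination (r * am : ℂ) * I_sq
  have h2 := h1
  rw [qqPoch_eq_mul hp hq] at h2
  have h3 := right_ne_zero_of_mul h2
  rw [G_eq_qqPoch hr hap ham h1, G_eq_qqPoch hr hap ham (by rw [e1]; exact h3),
    qqPoch_eq_mul hp hq (exp (-r * ap - r * am + -2 * I * r * (u + I * am))), e1, e2,
    R_eq_qPoch hr hap, e3, e4,
    qqPoch_eq_mul hp hq (exp (-r * ap - r * am + 2 * I * r * u))]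
  have key : ∀ A B C D : ℂ, A ≠ 0 → D * B / C = A * D * (B / (A * C)) := by
    intro A B C D hA
    field_simp
  exact key _ _ _ _ (left_ne_zero_of_mul h2)

theorem G_swap (r ap am : ℝ) (z : ℂ) : G r ap am z = G r am ap z := by
  rw [G, G, ← (Equiv.prodComm ℕ ℕ).tprod_eq]
  refine tprod_congr fun k => ?_
  simp only [Equiv.prodComm_apply, Prod.fst_swap, Prod.snd_swap]
  congr 3 <;> ring

theorem GRegular.swap {z : ℂ} (h : GRegular r ap am z) : GRegular r am ap z := by
  intro m n
  convert h n m using 3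
  ring

theorem aSign_pos (hap : 0 < ap) (ham : 0 < am) (δ : Bool) : 0 < aSign ap am δ := by
  cases δ <;> simpa [aSign]

theorem G_add_aSign (hr : 0 < r) (hap : 0 < ap) (ham : 0 < am) (δ : Bool) {u : ℂ}
    (h : GRegular r ap am u) :
    G r ap am (u + I * aSign ap am (!δ)) =
      RSign r ap am δ (u + I * aSign ap am (!δ) / 2) * G r ap am u := by
  cases δ
  · rw [G_swap, G_swap r ap am u]
    exact G_add hr ham hap h.swap
  · exact G_add hr hap ham h

end gamma

/-! ### From the difference operator to the reduced sum -/

section reduction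

variable {r ap am : ℝ}

/-- Splitting off the uniform shift by `-i a_{-δ}/3` leaves a full step of `G_add_aSign` in row `j`
alone. -/
theorem kernelArg_shift (δ : Bool) (v w z : Fin 3 → ℂ) (j k l m : Fin 3) :
    kernelArg ap am (shift (aSign ap am (!δ)) j v) w z k l m =
      kernelArg ap am v w z k l m - I * aSign ap am (!δ) / 3 +
        if k = j then I * aSign ap am (!δ) else 0 := by
  simp only [kernelArg, shift]
  split_ifs <;> ring

/-- The part of the shifted kernel function that does not depend on the summand of the difference
operator. -/
def commonFactor (r ap am : ℝ) (δ : Bool) (v w z : Fin 3 → ℂ) : ℂ :=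
  ∏ k, ∏ l, ∏ m, G r ap am (kernelArg ap am v w z k l m - I * aSign ap am (!δ) / 3)

theorem commonFactor_comm (δ : Bool) (v w z : Fin 3 → ℂ) :
    commonFactor r ap am δ v w z = commonFactor r ap am δ w v z := by
  rw [commonFactor, Finset.prod_comm]
  refine Finset.prod_congr rfl fun k _ => Finset.prod_congr rfl fun l _ =>
    Finset.prod_congr rfl fun m _ => ?_
  rw [kernelArg, kernelArg, add_comm (v l)]

theorem S2_shift (hr : 0 < r) (hap : 0 < ap) (ham : 0 < am) (δ : Bool) {v w z : Fin 3 → ℂ}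
    (h : ∀ k l m, GRegular r ap am (kernelArg ap am v w z k l m - I * aSign ap am (!δ) / 3))
    (j : Fin 3) :
    S2 r ap am (shift (aSign ap am (!δ)) j v) w z =
      (∏ l, ∏ m, RSign r ap am δ (v j + w l + z m - I * aSign ap am δ / 6)) *
        commonFactor r ap am δ v w z := by
  have hfac : ∀ k l m, G r ap am (kernelArg ap am (shift (aSign ap am (!δ)) j v) w z k l m) =
      (if k = j then RSign r ap am δ (v j + w l + z m - I * aSign ap am δ / 6) else 1) *
        G r ap am (kernelArg ap am v w z k l m - I * aSign ap am (!δ) / 3) := by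
    intro k l m
    rw [kernelArg_shift]
    split_ifs with hk
    · subst hk
      rw [G_add_aSign hr hap ham δ (h k l m)]
      congr 2
      cases δ <;> simp [kernelArg, aSign] <;> ring
    · rw [add_zero, one_mul]
  simp only [S2, hfac, Finset.prod_mul_distrib, commonFactor]
  congr 1
  rw [Fintype.prod_eq_single j]
  · simp
  · intro k hk
    simp [hk]

/-- Any summand with index different from `k` evaluates `G` at exactly this point. -/
theorem GRegular_of_A2Regular {δ : Bool} {v w z : Fin 3 → ℂ}
    (h : A2Regular r ap am δ (fun x => S2Regular r ap am x w z) v) (k l m : Fin 3) :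
    GRegular r ap am (kernelArg ap am v w z k l m - I * aSign ap am (!δ) / 3) := by
  have hk : ∀ k : Fin 3, k ≠ k + 1 := by decide
  have := h.2 (k + 1) k l m
  rwa [kernelArg_shift, if_neg (hk k), add_zero] at this

theorem R_eq_sigma (r α : ℝ) (y : ℂ) :
    R r α y = exp (I * r * (y + I * α / 2)) * sigma r α (y + I * α / 2) := by
  rw [sigma, ← mul_assoc, ← exp_add, add_sub_cancel_right, neg_mul, neg_mul, add_neg_cancel,
    exp_zero, one_mul]

theorem R_eq_sigma_sub {α : ℝ} (hr : 0 < r) (hα : 0 < α) (y : ℂ) :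
    R r α y = -(exp (-I * r * (y - I * α / 2)) * sigma r α (y - I * α / 2)) := by
  rw [R_eq_sigma, show y + I * α / 2 = y - I * α / 2 + α * I by ring,
    sigma_add_quasiperiod hr hα]
  rw [neg_mul, mul_neg, ← mul_assoc, ← exp_add, ← exp_add]
  congr 3
  linear_combination (r * α : ℂ) * I_sq

/-- Each `R` is a `sigma` moved by half a quasi-period up or down. Going down for `m = 0` and up for
`m = 1, 2` gives the offsets `-2, 1, 1`, so `z'` still sums to zero. The prefactor is free of `v`
and `w`. -/
theorem sum_coeff_mul_eq (hr : 0 < r) (hap : 0 < ap) (ham : 0 < am) (δ : Bool) (μ : ℂ)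
    {v w z : Fin 3 → ℂ} (hv : ∑ j, v j = 0) (hw : ∑ j, w j = 0) (hz : ∑ j, z j = 0)
    {z' : Fin 3 → ℂ} (hz' : z' = fun m => z m + I * aSign ap am δ / 3 * ![-2, 1, 1] m) :
    ∑ j, coeff r ap am δ μ j v *
        ∏ l, ∏ m, RSign r ap am δ (v j + w l + z m - I * aSign ap am δ / 6) =
      exp (2 * I * r * (μ + I * aSign ap am δ / 2) - 6 * I * r * z' 0) *
        razSum (sigma r (aSign ap am δ)) (μ + I * aSign ap am δ / 2) v w z' := by
  have ha := aSign_pos hap ham δ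
  simp only [coeff, RSign]
  set a := aSign ap am δ
  set ν := μ + I * a / 2 with hν
  set s := sigma r a with hs
  rw [razSum, Finset.mul_sum]
  refine Finset.sum_congr rfl fun j _ => ?_
  have hnum : ∀ x, R r a (x + μ) * R r a (x - μ) =
      -(exp (2 * I * r * ν) * (s (x + ν) * s (x - ν))) := by
    intro x
    rw [R_eq_sigma, R_eq_sigma_sub hr ha, show x + μ + I * a / 2 = x + ν by rw [hν]; ring,
      show x - μ - I * a / 2 = x - ν by rw [hν]; ring,
      show 2 * I * r * ν = I * r * (x + ν) + -I * r * (x - ν) by ring, exp_add]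
    ring
  have hden : ∀ x, R r a (x - I * a / 2) = exp (I * r * x) * s x := by
    intro x
    rw [R_eq_sigma, sub_add_cancel]
  have hm : ∀ x, ∏ m, R r a (x + z m - I * a / 6) =
      -(exp (I * r * (x - 2 * z' 0)) * ∏ m, s (x + z' m)) := by
    intro x
    rw [Fin.sum_univ_three] at hz
    have hz0 : z' 0 = z 0 - 2 * (I * a / 3) := by rw [hz']; simp; ring
    have hz1 : z' 1 = z 1 + I * a / 3 := by rw [hz']; simp
    have hz2 : z' 2 = z 2 + I * a / 3 := by rw [hz']; simp
    rw [Fin.prod_univ_three, Fin.prod_univ_three, R_eq_sigma_sub hr ha, R_eq_sigma r a (x + z 1 - _),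
      R_eq_sigma r a (x + z 2 - _),
      show x + z 0 - I * a / 6 - I * a / 2 = x + z' 0 by rw [hz0]; ring,
      show x + z 1 - I * a / 6 + I * a / 2 = x + z' 1 by rw [hz1]; ring,
      show x + z 2 - I * a / 6 + I * a / 2 = x + z' 2 by rw [hz2]; ring,
      show I * r * (x - 2 * z' 0) =
        -I * r * (x + z' 0) + I * r * (x + z' 1) + I * r * (x + z' 2) by
          rw [hz0, hz1, hz2]; linear_combination (-I * r) * hz, exp_add, exp_add]
    ring
  have hlm : ∏ l, ∏ m, R r a (v j + w l + z m - I * a / 6) =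
      -(exp (3 * I * r * v j) * exp (-(6 * I * r * z' 0)) *
        ∏ l, ∏ m, s (v j + w l + z' m)) := by
    rw [Fin.sum_univ_three] at hw
    simp only [hm]
    rw [← exp_add, show 3 * I * r * v j + -(6 * I * r * z' 0) = I * r * (v j + w 0 - 2 * z' 0) +
      I * r * (v j + w 1 - 2 * z' 0) + I * r * (v j + w 2 - 2 * z' 0) by
        linear_combination (-I * r) * hw, exp_add, exp_add]
    simp only [Fin.prod_univ_three]
    ring
  -- Because `v` sums to zero, the exponentials of the denominator cancel those of the kernel,
  -- leaving no dependence on `j`.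
  have hexp : exp (I * r * (v j - v (j + 1))) * exp (I * r * (v j - v (j + 2))) =
      exp (3 * I * r * v j) := by
    have hsum : v j + v (j + 1) + v (j + 2) = 0 := by
      rw [← hv, Fin.sum_univ_three]
      fin_cases j <;> simp <;> ring
    rw [← exp_add]
    congr 1
    linear_combination (-I * r) * hsum
  have hsplit : exp (2 * I * r * ν - 6 * I * r * z' 0) =
      exp (2 * I * r * ν) * exp (-(6 * I * r * z' 0)) := by
    rw [← exp_add, sub_eq_add_neg]
  have key : ∀ A B E N P S : ℂ, A ≠ 0 → -(E * N) / (A * S) * -(A * B * P) = E * B * (N / S * P) := by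
    intro A B E N P S hA
    field_simp
  rw [hnum, hden, hden, hlm, razTerm, hsplit, mul_mul_mul_comm (exp _) (s _), hexp]
  exact key _ _ _ _ _ _ (exp_ne_zero _)

theorem A2_S2_eq (hr : 0 < r) (hap : 0 < ap) (ham : 0 < am) (δ : Bool) (μ : ℂ)
    {v w z : Fin 3 → ℂ} (h : A2Regular r ap am δ (fun x => S2Regular r ap am x w z) v) :
    A2 r ap am δ μ (fun x => S2 r ap am x w z) v =
      (∑ j, coeff r ap am δ μ j v *
        ∏ l, ∏ m, RSign r ap am δ (v j + w l + z m - I * aSign ap am δ / 6)) *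
          commonFactor r ap am δ v w z := by
  rw [A2, Finset.sum_mul]
  refine Finset.sum_congr rfl fun j _ => ?_
  rw [S2_shift hr hap ham δ (GRegular_of_A2Regular h), mul_assoc]

theorem sigma_sub_ne_zero {δ : Bool} {reg : (Fin 3 → ℂ) → Prop} {v : Fin 3 → ℂ}
    (h : A2Regular r ap am δ reg v) (j k : Fin 3) (hjk : j ≠ k) :
    sigma r (aSign ap am δ) (v j - v k) ≠ 0 :=
  mul_ne_zero (exp_ne_zero _) (h.1 j k hjk)

theorem A2_S2_comm (hr : 0 < r) (hap : 0 < ap) (ham : 0 < am) (δ : Bool) (μ : ℂ)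
    {v w z : Fin 3 → ℂ} (hv : ∑ j, v j = 0) (hw : ∑ j, w j = 0) (hz : ∑ j, z j = 0)
    (h : A2Regular r ap am δ (fun x => S2Regular r ap am x w z) v)
    (h' : A2Regular r ap am δ (fun x => S2Regular r ap am x v z) w) :
    A2 r ap am δ μ (fun x => S2 r ap am x w z) v =
      A2 r ap am δ μ (fun x => S2 r ap am x v z) w := by
  have ha := aSign_pos hap ham δ
  -- The value at `v 0 - v 1` shows that `sigma` is not identically zero, so its zeros are
  -- countable.
  rw [A2_S2_eq hr hap ham δ μ h, A2_S2_eq hr hap ham δ μ h', commonFactor_comm δ w v z,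
    sum_coeff_mul_eq hr hap ham δ μ hv hw hz rfl, sum_coeff_mul_eq hr hap ham δ μ hw hv hz rfl,
    razSum_comm (sigmaLike_sigma hr ha) (differentiable_sigma hr ha).continuous
      (countable_sigma_zeros hr ha (sigma_sub_ne_zero h 0 1 (by decide))) _ hv hw ?_
      (sigma_sub_ne_zero h) (sigma_sub_ne_zero h')]
  rw [Fin.sum_univ_three] at hz ⊢
  simp only [Matrix.cons_val_zero, Matrix.cons_val_one, Matrix.cons_val]
  linear_combination hz

theorem S2_swap_first (r ap am : ℝ) (v w z : Fin 3 → ℂ) :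
    S2 r ap am v w z = S2 r ap am w v z := by
  rw [S2, Finset.prod_comm]
  simp only [S2, kernelArg, add_comm]

theorem S2_swap_last (r ap am : ℝ) (v w z : Fin 3 → ℂ) :
    S2 r ap am v w z = S2 r ap am v z w := by
  refine Finset.prod_congr rfl fun k _ => ?_
  rw [Finset.prod_comm]
  simp only [kernelArg, add_right_comm]

theorem S2Regular_swap_first (r ap am : ℝ) (v w z : Fin 3 → ℂ) :
    S2Regular r ap am v w z ↔ S2Regular r ap am w v z := by
  simp only [S2Regular, kernelArg]
  exact ⟨fun h k l m => by rw [add_comm (w k)]; exact h l k m,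
    fun h k l m => by rw [add_comm (v k)]; exact h l k m⟩

theorem S2Regular_swap_last (r ap am : ℝ) (v w z : Fin 3 → ℂ) :
    S2Regular r ap am v w z ↔ S2Regular r ap am v z w := by
  simp only [S2Regular, kernelArg]
  exact ⟨fun h k l m => by rw [add_right_comm]; exact h k m l,
    fun h k l m => by rw [add_right_comm]; exact h k m l⟩

end reduction

end Razamat

end

/-! ### The three equalities -/

theorem corollary2p3 (r ap am : ℝ) (hr : 0 < r) (hap : 0 < ap) (ham : 0 < am)
    (δ : Bool) (μ : ℂ) (v w z : Fin 3 → ℂ)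
    (hv : ∑ j, v j = 0) (hw : ∑ j, w j = 0) (hz : ∑ j, z j = 0) :
    (Razamat.A2Regular r ap am δ (fun x => Razamat.S2Regular r ap am x w z) v →
      Razamat.A2Regular r ap am δ (fun x => Razamat.S2Regular r ap am v x z) w →
      Razamat.A2 r ap am δ μ (fun x => Razamat.S2 r ap am x w z) v =
        Razamat.A2 r ap am δ μ (fun x => Razamat.S2 r ap am v x z) w) ∧
    (Razamat.A2Regular r ap am δ (fun x => Razamat.S2Regular r ap am v x z) w →
      Razamat.A2Regular r ap am δ (fun x => Razamat.S2Regular r ap am v w x) z →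
      Razamat.A2 r ap am δ μ (fun x => Razamat.S2 r ap am v x z) w =
        Razamat.A2 r ap am δ μ (fun x => Razamat.S2 r ap am v w x) z) ∧
    (Razamat.A2Regular r ap am δ (fun x => Razamat.S2Regular r ap am x w z) v →
      Razamat.A2Regular r ap am δ (fun x => Razamat.S2Regular r ap am v w x) z →
      Razamat.A2 r ap am δ μ (fun x => Razamat.S2 r ap am x w z) v =
        Razamat.A2 r ap am δ μ (fun x => Razamat.S2 r ap am v w x) z) := by
  -- As `S2` is symmetric in its arguments, the active variable can always be moved to the first
  -- slot.
  have f1 : (fun x => Razamat.S2 r ap am v x z) = fun x => Razamat.S2 r ap am x v z :=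
    funext fun x => Razamat.S2_swap_first r ap am v x z
  have g1 : (fun x => Razamat.S2Regular r ap am v x z) = fun x => Razamat.S2Regular r ap am x v z :=
    funext fun x => propext (Razamat.S2Regular_swap_first r ap am v x z)
  have f2 : (fun x => Razamat.S2 r ap am v w x) = fun x => Razamat.S2 r ap am x v w :=
    funext fun x => by rw [Razamat.S2_swap_last, Razamat.S2_swap_first]
  have g2 : (fun x => Razamat.S2Regular r ap am v w x) = fun x => Razamat.S2Regular r ap am x v w :=
    funext fun x => propext (by rw [Razamat.S2Regular_swap_last, Razamat.S2Regular_swap_first])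
  have f3 : ∀ a b, (fun x => Razamat.S2 r ap am x a b) = fun x => Razamat.S2 r ap am x b a :=
    fun a b => funext fun x => Razamat.S2_swap_last r ap am x a b
  have g3 : ∀ a b, (fun x => Razamat.S2Regular r ap am x a b) =
      fun x => Razamat.S2Regular r ap am x b a :=
    fun a b => funext fun x => propext (Razamat.S2Regular_swap_last r ap am x a b)
  rw [f1, g1, f2, g2]
  refine ⟨Razamat.A2_S2_comm hr hap ham δ μ hv hw hz, ?_, ?_⟩
  · rw [f3 v z, g3 v z, f3 v w, g3 v w]
    exact Razamat.A2_S2_comm hr hap ham δ μ hw hz hv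
  · rw [f3 w z, g3 w z]
    exact Razamat.A2_S2_comm hr hap ham δ μ hv hz hw
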